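/- Let $\mathbb T=\mathbb R/2\pi\mathbb Z$. For a continuous real function $f$ on $\mathbb T$ with Fourier coefficients $\hat f_n=\frac1{2\pi}\int_{\mathbb T} f(x)e^{-inx}\,dx$, let $T(f)=(\hat f_{i-j})_{i,j\ge 0}$ be the Toeplitz operator with symbol $f$ on $\ell^2(\mathbb N)$. Let $a,\theta\in\mathbb R$ with $|\theta|<1$ and $$f(x)=a+\cos x,\qquad g(x)=\frac1{1+\theta^2-2\theta\cos x}.$$ Then $\|f\|_\infty=|a|+1$, $\|g\|_\infty=(1-|\theta|)^{-2}$, and $$\inf(fg)=\min\Big(\frac{a-1}{(1+\theta)^2},\frac{a+1}{(1-\theta)^2}\Big),\qquad \sup(fg)=\max\Big(\frac{a-1}{(1+\theta)^2},\frac{a+1}{(1-\theta)^2}\Big).$$ Moreover, the spectrum of $T(f)T(g)$ is real and has a maximum $\lambda_{\max}$ and a minimum $\lambda_{\min}$, which are as follows. (i) If $\theta=0$, then $g=1$, $T(f)T(g)=T(f)$, $\lambda_{\max}=a+1$ and $\lambda_{\min}=a-1$. For $\theta\ne0$ put $a_\theta=-\frac{1+\theta}{2\theta}$ and $b_\theta=-\frac{1-\theta}{2\theta}$.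 (ii) If $\theta>0$, then $\lambda_{\max}=\sup(fg)$; if $a\in\,]a_\theta,b_\theta[$ then $\lambda_{\min}=-\frac{1}{4\theta(1+a\theta)}<\inf(fg)$, and otherwise $\lambda_{\min}=\inf(fg)$. (iii) If $\theta<0$, then $\lambda_{\min}=\inf(fg)$; if $a\in\,]a_\theta,b_\theta[$ then $\lambda_{\max}=-\frac{1}{4\theta(1+a\theta)}>\sup(fg)$, and otherwise $\lambda_{\max}=\sup(fg)$. -/

import Mathlib

open MeasureTheory AddCircle
open scoped ENNReal

noncomputable section

/-- The torus `ℝ / 2πℤ`; `haarAddCircle` is the normalized measure `dx / 2π` on it. -/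
abbrev Torus : Type := AddCircle (2 * Real.pi)

instance torusFact : Fact (0 < 2 * Real.pi) := ⟨Real.two_pi_pos⟩

/-- The Hilbert space `L²(𝕋)`. -/
abbrev L2Torus : Type := Lp ℂ 2 (haarAddCircle (T := 2 * Real.pi))

/-- The Hilbert space `ℓ²(ℕ)`. -/
abbrev ell2 : Type := lp (fun _ : ℕ => ℂ) 2

/-- The characters `e^{ikx}`, `k ≥ 0`, are orthonormal in `L²(𝕋)`. -/
theorem orthonormal_fourier_nat :
    Orthonormal ℂ (fun k : ℕ => (fourierLp 2 (k : ℤ) : L2Torus)) :=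
  orthonormal_fourier.comp (fun k : ℕ => (k : ℤ)) Nat.cast_injective

/-- The isometry `ℓ²(ℕ) → L²(𝕋)`, `(u_k) ↦ ∑_{k ≥ 0} u_k e^{ikx}`. Its range is the space of
functions with no negative frequencies. -/
def hardyEmb : ell2 →ₗᵢ[ℂ] L2Torus :=
  orthonormal_fourier_nat.orthogonalFamily.linearIsometry

/-- The bounded operator of multiplication by `f ∈ L^∞(𝕋)` on `L²(𝕋)`. -/
def mulOp (f : Lp ℂ ∞ (haarAddCircle (T := 2 * Real.pi))) : L2Torus →L[ℂ] L2Torus :=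
  (ContinuousLinearMap.mul ℂ ℂ).holderL haarAddCircle ∞ 2 2 f

/-- The Toeplitz operator on `ℓ²(ℕ)` with symbol `f ∈ L^∞(𝕋)`: multiplication by `f`, cut off to
nonnegative frequencies. Its matrix is `(f̂_{i-j})_{i,j ≥ 0}`, see `toeplitzLp_entry`. -/
def toeplitzLp (f : Lp ℂ ∞ (haarAddCircle (T := 2 * Real.pi))) : ell2 →L[ℂ] ell2 :=
  (ContinuousLinearMap.adjoint hardyEmb.toContinuousLinearMap) ∘L mulOp f ∘L
    hardyEmb.toContinuousLinearMap

/-- The matrix of the Toeplitz operator in the canonical basis of `ℓ²(ℕ)`. -/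
theorem toeplitzLp_entry (f : Lp ℂ ∞ (haarAddCircle (T := 2 * Real.pi))) (i j : ℕ) :
    (toeplitzLp f (lp.single 2 j (1 : ℂ)) : ℕ → ℂ) i = fourierCoeff f ((i : ℤ) - j) := by
  have hj : hardyEmb (lp.single 2 j (1 : ℂ)) = fourierLp 2 (j : ℤ) := by
    rw [hardyEmb, OrthogonalFamily.linearIsometry_apply_single]
    simp
  have hi : hardyEmb (lp.single 2 i (1 : ℂ)) = fourierBasis (i : ℤ) := by
    rw [hardyEmb, OrthogonalFamily.linearIsometry_apply_single]
    simp
  have h1 : (toeplitzLp f (lp.single 2 j (1 : ℂ)) : ℕ → ℂ) i =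
      inner ℂ (lp.single 2 i (1 : ℂ) : ell2) (toeplitzLp f (lp.single 2 j (1 : ℂ))) := by
    rw [lp.inner_single_left]
    simp
  rw [h1, toeplitzLp, ContinuousLinearMap.comp_apply, ContinuousLinearMap.adjoint_inner_right,
    ContinuousLinearMap.comp_apply]
  change inner ℂ (hardyEmb _) (mulOp f (hardyEmb _)) = _
  rw [hi, hj, ← HilbertBasis.repr_apply_apply, fourierBasis_repr]
  refine integral_congr_ae ?_
  have h2 := (ContinuousLinearMap.mul ℂ ℂ).coeFn_holder (r := 2) f
    (fourierLp 2 (j : ℤ) : L2Torus)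
  filter_upwards [h2, coeFn_fourierLp (T := 2 * Real.pi) 2 (j : ℤ)] with x hx hx'
  have h3 : (mulOp f (fourierLp 2 (j : ℤ)) : Torus → ℂ) x = f x * fourier (j : ℤ) x := by
    rw [← hx']
    exact hx
  rw [h3, show -((i : ℤ) - j) = -i + j by ring, fourier_add]
  simp only [smul_eq_mul]
  ring

/-- A continuous real-valued function on the torus, as an element of `L^∞(𝕋)`. -/
def symbolLp (f : C(Torus, ℝ)) : Lp ℂ ∞ (haarAddCircle (T := 2 * Real.pi)) :=
  ContinuousMap.toLp ∞ haarAddCircle ℂ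
    (⟨fun x => (f x : ℂ), Complex.continuous_ofReal.comp f.continuous⟩ : C(Torus, ℂ))

/-- The Toeplitz operator `T(f)` on `ℓ²(ℕ)` of a continuous real symbol. -/
def toeplitz (f : C(Torus, ℝ)) : ell2 →L[ℂ] ell2 := toeplitzLp (symbolLp f)

/-- The matrix of `T(f)` is `(f̂_{i-j})_{i,j ≥ 0}`. -/
theorem toeplitz_entry (f : C(Torus, ℝ)) (i j : ℕ) :
    (toeplitz f (lp.single 2 j (1 : ℂ)) : ℕ → ℂ) i =
      fourierCoeff (fun x => (f x : ℂ)) ((i : ℤ) - j) := by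
  rw [toeplitz, toeplitzLp_entry]
  refine integral_congr_ae ?_
  filter_upwards [ContinuousMap.coeFn_toLp (p := ∞) (𝕜 := ℂ)
    (haarAddCircle (T := 2 * Real.pi))
    (⟨fun x => (f x : ℂ), Complex.continuous_ofReal.comp f.continuous⟩ : C(Torus, ℂ))] with x hx
  rw [symbolLp, hx]
  rfl

/-- `m = max σ(A)`: the spectrum of `A` is real and `m` is its largest element. -/
def IsSpectralMax (A : ell2 →L[ℂ] ell2) (m : ℝ) : Prop :=
  (m : ℂ) ∈ spectrum ℂ A ∧ ∀ z ∈ spectrum ℂ A, z.im = 0 ∧ z.re ≤ m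

/-- `m = min σ(A)`: the spectrum of `A` is real and `m` is its smallest element. -/
def IsSpectralMin (A : ell2 →L[ℂ] ell2) (m : ℝ) : Prop :=
  (m : ℂ) ∈ spectrum ℂ A ∧ ∀ z ∈ spectrum ℂ A, z.im = 0 ∧ m ≤ z.re

end

/-! Let `S` be the shift and `X = 1 - θS`. Since `1/g = |1 - θe^{ix}|²`, the Wiener–Hopf identity
`X* T(g) X = 1` gives `T(g) = (XX*)⁻¹`, so `z - T(f)T(g) = (z XX* - T(f)) T(g)` and `z` is spectral
exactly when `z XX* - T(f)` is singular. If this operator is positive and singular at `z = m`, then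
`m` is the spectral maximum: for `z` off the real line or beyond `m`, adding `(z - m)XX*` keeps the
quadratic form away from 0 (`isSpectralMax_mul_of_isPositive`).

Here `m XX* - T(f)` is the Jacobi operator `α - β(S + S*) - γ(1 - SS*)` with `α = m(1 + θ²) - a`, `β
= 1/2 + mθ`, `γ = mθ²`. A weak corner, `γ ≤ |β|`, leaves the bottom of its spectrum at the edge `α -
2|β|`; a strong one, `γ > |β|`, creates an eigenvalue `α - γ - β²/γ` below it. Vanishing of the edge
corresponds to `m = sup(fg)`; vanishing of the eigenvalue is linear in `m` and gives `m = -1/(4θ(1 +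
aθ))`. Which regime holds is a question of scalar inequalities. The minimum follows from the
symmetry `(a, θ, m) ↦ (-a, -θ, -m)`. -/

/-! ### Multiplication operators on `L²(𝕋)` -/

/-- Multiplication by a continuous function on `L²(𝕋)`. -/
noncomputable def contMulOp (φ : C(Torus, ℂ)) : L2Torus →L[ℂ] L2Torus :=
  mulOp (ContinuousMap.toLp ∞ haarAddCircle ℂ φ)

theorem coeFn_contMulOp (φ : C(Torus, ℂ)) (u : L2Torus) :
    (contMulOp φ u : Torus → ℂ) =ᵐ[haarAddCircle] fun x => φ x * u x := by
  have h := (ContinuousLinearMap.mul ℂ ℂ).coeFn_holder (r := 2)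
    (ContinuousMap.toLp ∞ (haarAddCircle (T := 2 * Real.pi)) ℂ φ) u
  filter_upwards [h, ContinuousMap.coeFn_toLp (p := ∞) (𝕜 := ℂ)
    (haarAddCircle (T := 2 * Real.pi)) φ] with x hx hφ
  rw [← hφ]
  exact hx

theorem contMulOp_add (φ ψ : C(Torus, ℂ)) : contMulOp (φ + ψ) = contMulOp φ + contMulOp ψ := by
  simp only [contMulOp, mulOp, map_add]

theorem contMulOp_smul (c : ℂ) (φ : C(Torus, ℂ)) : contMulOp (c • φ) = c • contMulOp φ := by
  simp only [contMulOp, mulOp, map_smul]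

theorem contMulOp_sub (φ ψ : C(Torus, ℂ)) : contMulOp (φ - ψ) = contMulOp φ - contMulOp ψ := by
  simp only [contMulOp, mulOp, map_sub]

theorem contMulOp_one : contMulOp 1 = 1 := by
  ext1 u
  refine Lp.ext ?_
  filter_upwards [coeFn_contMulOp 1 u] with x hx
  simpa using hx

theorem contMulOp_mul (φ ψ : C(Torus, ℂ)) : contMulOp (φ * ψ) = contMulOp φ * contMulOp ψ := by
  ext1 u
  refine Lp.ext ?_
  filter_upwards [coeFn_contMulOp (φ * ψ) u, coeFn_contMulOp φ (contMulOp ψ u),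
    coeFn_contMulOp ψ u] with x h1 h2 h3
  refine h1.trans (Eq.trans ?_ h2.symm)
  rw [h3, ContinuousMap.mul_apply, mul_assoc]

theorem adjoint_contMulOp (φ : C(Torus, ℂ)) :
    ContinuousLinearMap.adjoint (contMulOp φ) = contMulOp (star φ) := by
  symm
  rw [ContinuousLinearMap.eq_adjoint_iff]
  intro u v
  rw [L2.inner_def, L2.inner_def]
  refine integral_congr_ae ?_
  filter_upwards [coeFn_contMulOp (star φ) u, coeFn_contMulOp φ v] with x h1 h2
  rw [h1, h2]
  simp only [ContinuousMap.star_apply, RCLike.inner_apply, map_mul, RCLike.star_def,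
    Complex.conj_conj]
  ring

theorem contMulOp_fourier_fourierLp (m n : ℤ) :
    contMulOp (fourier m) (fourierLp 2 n : L2Torus) = fourierLp 2 (m + n) := by
  refine Lp.ext ?_
  filter_upwards [coeFn_contMulOp (fourier m) (fourierLp 2 n : L2Torus),
    coeFn_fourierLp (T := 2 * Real.pi) 2 n, coeFn_fourierLp (T := 2 * Real.pi) 2 (m + n)]
    with x h1 h2 h3
  rw [h1, h2, h3, fourier_add]

theorem hardyEmb_single (j : ℕ) :
    hardyEmb (lp.single 2 j (1 : ℂ)) = fourierLp 2 (j : ℤ) := by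
  rw [hardyEmb, OrthogonalFamily.linearIsometry_apply_single]
  simp

theorem adjoint_hardyEmb_apply (u : ell2) :
    ContinuousLinearMap.adjoint hardyEmb.toContinuousLinearMap (hardyEmb u) = u := by
  refine ext_inner_left ℂ fun v => ?_
  rw [ContinuousLinearMap.adjoint_inner_right]
  exact hardyEmb.inner_map_map v u

/-! ### Toeplitz operators with continuous symbol and the shift -/

/-- The Toeplitz operator of a continuous complex symbol. -/
noncomputable def contToeplitz (φ : C(Torus, ℂ)) : ell2 →L[ℂ] ell2 :=
  (ContinuousLinearMap.adjoint hardyEmb.toContinuousLinearMap) ∘L contMulOp φ ∘L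
    hardyEmb.toContinuousLinearMap

theorem contToeplitz_apply (φ : C(Torus, ℂ)) (u : ell2) :
    contToeplitz φ u = ContinuousLinearMap.adjoint hardyEmb.toContinuousLinearMap
      (contMulOp φ (hardyEmb u)) := rfl

theorem contToeplitz_add (φ ψ : C(Torus, ℂ)) :
    contToeplitz (φ + ψ) = contToeplitz φ + contToeplitz ψ := by
  ext1 u
  simp [contToeplitz_apply, contMulOp_add]

theorem contToeplitz_sub (φ ψ : C(Torus, ℂ)) :
    contToeplitz (φ - ψ) = contToeplitz φ - contToeplitz ψ := by
  ext1 u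
  simp [contToeplitz_apply, contMulOp_sub]

theorem contToeplitz_smul (c : ℂ) (φ : C(Torus, ℂ)) :
    contToeplitz (c • φ) = c • contToeplitz φ := by
  ext1 u
  simp [contToeplitz_apply, contMulOp_smul]

theorem contToeplitz_one : contToeplitz 1 = 1 := by
  ext1 u
  simp [contToeplitz_apply, contMulOp_one, adjoint_hardyEmb_apply]

theorem star_contToeplitz (φ : C(Torus, ℂ)) : star (contToeplitz φ) = contToeplitz (star φ) := by
  rw [ContinuousLinearMap.star_eq_adjoint, contToeplitz, contToeplitz,
    ContinuousLinearMap.adjoint_comp, ContinuousLinearMap.adjoint_comp,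
    ContinuousLinearMap.adjoint_adjoint, adjoint_contMulOp, ContinuousLinearMap.comp_assoc]

/-- The unilateral shift on `ℓ²(ℕ)`. -/
noncomputable def shiftOp : ell2 →L[ℂ] ell2 := contToeplitz (fourier 1)

theorem shiftOp_single (j : ℕ) :
    shiftOp (lp.single 2 j (1 : ℂ)) = lp.single 2 (j + 1) (1 : ℂ) := by
  rw [shiftOp, contToeplitz_apply, hardyEmb_single, contMulOp_fourier_fourierLp,
    show (1 : ℤ) + (j : ℤ) = ((j + 1 : ℕ) : ℤ) by push_cast; ring, ← hardyEmb_single,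
    adjoint_hardyEmb_apply]

/-- Multiplication by `e^{ix}` creates no negative frequency, so the projection in the Toeplitz
operator is not felt. This is what makes Toeplitz products with the shift exact. -/
theorem hardyEmb_shiftOp (u : ell2) :
    hardyEmb (shiftOp u) = contMulOp (fourier 1) (hardyEmb u) := by
  have h : hardyEmb.toContinuousLinearMap ∘L shiftOp =
      contMulOp (fourier 1) ∘L hardyEmb.toContinuousLinearMap := by
    refine lp.ext_continuousLinearMap (by simp) fun j => ?_
    refine ContinuousLinearMap.ext_ring ?_
    have : hardyEmb (shiftOp (lp.single 2 j (1 : ℂ))) =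
        contMulOp (fourier 1) (hardyEmb (lp.single 2 j (1 : ℂ))) := by
      rw [shiftOp_single, hardyEmb_single, hardyEmb_single, contMulOp_fourier_fourierLp]
      congr 1
      push_cast
      ring
    exact this
  exact DFunLike.congr_fun h u

/-- Multiplying the symbol on the right by `e^{ix}` composes the Toeplitz operator with the
shift. -/
theorem contToeplitz_mul_shiftOp (φ : C(Torus, ℂ)) :
    contToeplitz φ * shiftOp = contToeplitz (φ * fourier 1) := by
  ext1 u
  change contToeplitz φ (shiftOp u) = _
  rw [contToeplitz_apply, hardyEmb_shiftOp, contToeplitz_apply, contMulOp_mul]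
  rfl

theorem star_shiftOp_mul_contToeplitz (φ : C(Torus, ℂ)) :
    star shiftOp * contToeplitz φ = contToeplitz (star (fourier 1) * φ) := by
  rw [← star_star (contToeplitz φ), ← star_mul, star_contToeplitz, contToeplitz_mul_shiftOp,
    star_contToeplitz, star_mul, star_star]

theorem star_fourier_mul_fourier (n : ℤ) :
    star (fourier n : C(Torus, ℂ)) * fourier n = 1 := by
  ext x
  simp only [ContinuousMap.mul_apply, ContinuousMap.star_apply, RCLike.star_def,
    ContinuousMap.one_apply]
  rw [← fourier_neg, ← fourier_add]
  simp

theorem star_shiftOp_mul_shiftOp : star shiftOp * shiftOp = 1 := by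
  nth_rw 2 [shiftOp]
  rw [star_shiftOp_mul_contToeplitz, star_fourier_mul_fourier,
    contToeplitz_one]

theorem star_shiftOp_single_zero : star shiftOp (lp.single 2 0 (1 : ℂ)) = 0 := by
  have h : ∀ j : ℕ, ((star shiftOp (lp.single 2 0 (1 : ℂ)) : ell2) : ℕ → ℂ) j = 0 := fun j => by
    have h1 := lp.inner_single_left (𝕜 := ℂ) (G := fun _ : ℕ => ℂ) j (1 : ℂ)
      (star shiftOp (lp.single 2 0 (1 : ℂ)))
    rw [ContinuousLinearMap.star_eq_adjoint, ContinuousLinearMap.adjoint_inner_right,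
      shiftOp_single, lp.inner_single_left] at h1
    simpa [← ContinuousLinearMap.star_eq_adjoint] using h1.symm
  ext j
  simpa using h j

theorem norm_shiftOp_apply (u : ell2) : ‖shiftOp u‖ = ‖u‖ := by
  rw [ContinuousLinearMap.norm_map_iff_adjoint_comp_self shiftOp |>.mpr star_shiftOp_mul_shiftOp]

/-! ### From spectral extrema to positive singular operators -/

theorem IsUnit.mul_eq_one_of_mul_eq_one {M : Type*} [Monoid M] {a b : M} (ha : IsUnit a)
    (h : a * b = 1) : b * a = 1 := by
  obtain ⟨u, rfl⟩ := ha
  rw [Units.mul_eq_one_iff_inv_eq.mp h |>.symm, Units.inv_mul]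

theorem IsSpectralMax.neg {A : ell2 →L[ℂ] ell2} {m : ℝ} (h : IsSpectralMax (-A) (-m)) :
    IsSpectralMin A m := by
  rw [IsSpectralMax, ← spectrum.neg_eq] at h
  refine ⟨by simpa using h.1, fun z hz => ?_⟩
  have h2 := h.2 (-z) (by simpa using hz)
  simp only [Complex.neg_im, neg_eq_zero, Complex.neg_re] at h2
  exact ⟨h2.1, by linarith [h2.2]⟩

/-- If `K = mXX* - F` is positive and not invertible, where `X` is invertible and
`G = (XX*)⁻¹`, then `m` is the largest point of the spectrum of `FG`. -/
theorem isSpectralMax_mul_of_isPositive {F G X K : ell2 →L[ℂ] ell2} {m : ℝ} (hX : IsUnit X)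
    (hG : star X * G * X = 1) (hK : K = (m : ℂ) • (X * star X) - F) (hpos : K.IsPositive)
    (hunit : ¬ IsUnit K) : IsSpectralMax (F * G) m := by
  have hX' : IsUnit (star X) := hX.star
  have hGH : G * (X * star X) = 1 := by
    rw [← mul_assoc]
    exact hX'.mul_eq_one_of_mul_eq_one (by rw [← mul_assoc, hG])
  have hHG : X * star X * G = 1 := by
    obtain ⟨u, rfl⟩ := hX
    rw [mul_assoc, Units.mul_eq_one_iff_eq_inv.mp hG, Units.mul_inv]
  have hGu : IsUnit G := ⟨⟨G, X * star X, hGH, hHG⟩, rfl⟩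
  have hmul (z : ℂ) : algebraMap ℂ _ z - F * G = (z • (X * star X) - F) * G := by
    rw [sub_mul, smul_mul_assoc, hHG, Algebra.algebraMap_eq_smul_one]
  refine ⟨?_, fun z hz => ?_⟩
  · rw [spectrum.mem_iff, hmul, ← hK]
    intro h
    refine hunit ?_
    have := h.mul (⟨⟨X * star X, G, hHG, hGH⟩, rfl⟩ : IsUnit (X * star X))
    rwa [mul_assoc, hGH, mul_one] at this
  · by_contra hcon
    rw [spectrum.mem_iff, hmul] at hz
    refine hz (IsUnit.mul ?_ hGu)
    obtain ⟨Y, hY⟩ := hX'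
    -- The summand 1 only ensures `N > 0`.
    set N : ℝ := ‖(↑Y⁻¹ : ell2 →L[ℂ] ell2)‖ ^ 2 + 1 with hN
    have hNpos : 0 < N := by positivity
    have hbound (u : ell2) : ‖u‖ ^ 2 ≤ N * ‖star X u‖ ^ 2 := by
      have h1 : (↑Y⁻¹ : ell2 →L[ℂ] ell2) (star X u) = u := by
        have := DFunLike.congr_fun Y.inv_mul u
        rwa [hY] at this
      have h2 := (↑Y⁻¹ : ell2 →L[ℂ] ell2).le_opNorm (star X u)
      rw [h1] at h2
      calc ‖u‖ ^ 2 ≤ (‖(↑Y⁻¹ : ell2 →L[ℂ] ell2)‖ * ‖star X u‖) ^ 2 := by gcongr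
        _ ≤ N * ‖star X u‖ ^ 2 := by rw [mul_pow, hN]; gcongr; linarith
    set d : ℝ := max |z.im| (z.re - m) with hd
    have hdpos : 0 < d := by
      rw [hd, lt_max_iff, abs_pos, sub_pos]
      by_contra! h
      exact hcon h
    have hform (u : ell2) : inner ℂ ((z • (X * star X) - F) u) u =
        (starRingEnd ℂ) (z - m) * ((‖star X u‖ ^ 2 : ℝ) : ℂ) + inner ℂ (K u) u := by
      have h1 : (z • (X * star X) - F) = (z - m) • (X * star X) + K := by rw [hK]; module
      have h2 : inner ℂ ((X * star X) u) u = ((‖star X u‖ ^ 2 : ℝ) : ℂ) := by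
        change inner ℂ (X (star X u)) u = _
        rw [← ContinuousLinearMap.adjoint_inner_right, ← ContinuousLinearMap.star_eq_adjoint,
          inner_self_eq_norm_sq_to_K]
        simp
      rw [h1, add_apply, inner_add_left, smul_apply,
        inner_smul_left, h2]
    refine ContinuousLinearMap.isUnit_of_forall_le_norm_inner_map _
      (c := ⟨d / N, (div_pos hdpos hNpos).le⟩) (div_pos hdpos hNpos) fun u => ?_
    obtain ⟨hk1, hk2⟩ := Complex.nonneg_iff.mp (hpos.inner_nonneg_left u)
    have hle : d * ‖star X u‖ ^ 2 ≤ ‖inner ℂ ((z • (X * star X) - F) u) u‖ := by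
      rw [hform]
      set w := (starRingEnd ℂ) (z - m) * ((‖star X u‖ ^ 2 : ℝ) : ℂ) + inner ℂ (K u) u with hw
      have hre : w.re = (z.re - m) * ‖star X u‖ ^ 2 + (inner ℂ (K u) u : ℂ).re := by
        rw [hw, Complex.add_re, Complex.re_mul_ofReal]; simp
      have him : w.im = -(z.im * ‖star X u‖ ^ 2) := by
        rw [hw, Complex.add_im, Complex.im_mul_ofReal, ← hk2]; simp
      -- The form of `K` is real and nonnegative: it leaves the imaginary part untouched and can
      -- only raise the real part.
      rw [hd, max_mul_of_nonneg _ _ (sq_nonneg _)]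
      refine max_le ?_ ?_
      · refine le_trans (le_of_eq ?_) (Complex.abs_im_le_norm w)
        rw [him, abs_neg, abs_mul, abs_of_nonneg (sq_nonneg ‖star X u‖)]
      · exact le_trans (by rw [hre]; linarith) (Complex.re_le_norm w)
    refine le_trans ?_ hle
    change ‖u‖ ^ 2 * (d / N) ≤ _
    rw [mul_div_assoc', div_le_iff₀ hNpos]
    nlinarith [mul_le_mul_of_nonneg_left (hbound u) hdpos.le]

/-! ### Jacobi operators with a perturbed corner -/

/-- The Jacobi operator `α - β(S + S*) - γ(1 - SS*)`, where `S` is the shift. -/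
noncomputable def cornerJacobi (α β γ : ℝ) : ell2 →L[ℂ] ell2 :=
  ((α - γ : ℝ) : ℂ) • 1 - (β : ℂ) • (shiftOp + star shiftOp) +
    (γ : ℂ) • (shiftOp * star shiftOp)

theorem isPositive_mul_star (X : ell2 →L[ℂ] ell2) : (X * star X).IsPositive :=
  X.isPositive_self_comp_adjoint

/-- Because `S*S = 1`, this operator is a self-adjoint idempotent, hence equal to itself times its
adjoint. -/
theorem isPositive_one_sub_shiftOp_mul_star :
    (1 - shiftOp * star shiftOp : ell2 →L[ℂ] ell2).IsPositive := by
  have h : (1 - shiftOp * star shiftOp : ell2 →L[ℂ] ell2) =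
      (1 - shiftOp * star shiftOp) * star (1 - shiftOp * star shiftOp) := by
    simp only [star_sub, star_one, star_mul, star_star, mul_sub, sub_mul, one_mul, mul_one]
    have h1 : shiftOp * star shiftOp * (shiftOp * star shiftOp) = shiftOp * star shiftOp := by
      rw [mul_assoc, ← mul_assoc (star shiftOp), star_shiftOp_mul_shiftOp, one_mul]
    rw [h1, sub_self, sub_zero]
  rw [h]
  exact isPositive_mul_star _

theorem cornerJacobi_eq_mul_star {α β γ r : ℝ} (hβ : β = γ * r) (hα : α = γ * (1 + r ^ 2)) :
    cornerJacobi α β γ = (γ : ℂ) •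
      ((shiftOp - (r : ℂ) • 1) * star (shiftOp - (r : ℂ) • 1 : ell2 →L[ℂ] ell2)) := by
  subst hβ hα
  simp only [cornerJacobi, star_sub, star_smul, star_one, RCLike.star_def, Complex.conj_ofReal,
    mul_sub, sub_mul, smul_mul_assoc, mul_smul_comm, one_mul, mul_one]
  push_cast
  module

theorem isUnit_one_sub_smul_shiftOp {r : ℝ} (hr : |r| < 1) :
    IsUnit (1 - (r : ℂ) • shiftOp : ell2 →L[ℂ] ell2) := by
  refine isUnit_one_sub_of_norm_lt_one ?_
  refine lt_of_le_of_lt ?_ hr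
  refine ContinuousLinearMap.opNorm_le_bound _ (abs_nonneg r) fun u => ?_
  rw [smul_apply, norm_smul, norm_shiftOp_apply, Complex.norm_real,
    Real.norm_eq_abs]

theorem single_zero_ne_zero : (lp.single 2 0 (1 : ℂ) : ell2) ≠ 0 := by
  intro h
  have := congrArg (fun u : ell2 => u 0) h
  simp at this

/-- `α` is the eigenvalue created below the spectrum by a strong corner perturbation. -/
theorem cornerJacobi_isPositive_of_lt {α β γ : ℝ} (h : |β| < γ) (hα : α * γ = γ ^ 2 + β ^ 2) :
    (cornerJacobi α β γ).IsPositive ∧ ¬ IsUnit (cornerJacobi α β γ) := by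
  have hγ : 0 < γ := (abs_nonneg β).trans_lt h
  have hJ := cornerJacobi_eq_mul_star (α := α) (β := β) (γ := γ) (r := β / γ) (by field_simp)
    (by field_simp; linarith)
  refine ⟨?_, fun hu => ?_⟩
  · rw [hJ]
    exact (isPositive_mul_star _).smul_of_nonneg (by exact_mod_cast hγ.le)
  · set r := β / γ
    have hr : |r| < 1 := by rwa [abs_div, abs_of_pos hγ, div_lt_one hγ]
    -- Since `S*` kills `e₀`, this factorization puts `(1 - rS)⁻¹e₀` in the kernel; it is the bound
    -- state of the corner.
    have hfac : star (shiftOp - (r : ℂ) • 1 : ell2 →L[ℂ] ell2) =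
        star shiftOp * (1 - (r : ℂ) • shiftOp) := by
      simp only [star_sub, star_smul, star_one, RCLike.star_def, Complex.conj_ofReal, mul_sub,
        mul_smul_comm, mul_one, star_shiftOp_mul_shiftOp]
    obtain ⟨u, hu⟩ := hu
    obtain ⟨v, hv⟩ := isUnit_one_sub_smul_shiftOp hr
    have hker : cornerJacobi α β γ ((↑v⁻¹ : ell2 →L[ℂ] ell2) (lp.single 2 0 (1 : ℂ))) = 0 := by
      have h1 : (1 - (r : ℂ) • shiftOp : ell2 →L[ℂ] ell2)
          ((↑v⁻¹ : ell2 →L[ℂ] ell2) (lp.single 2 0 (1 : ℂ))) = lp.single 2 0 (1 : ℂ) := by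
        rw [← hv]
        exact DFunLike.congr_fun v.mul_inv _
      rw [hJ, hfac]
      change (γ : ℂ) • (shiftOp - (r : ℂ) • 1 : ell2 →L[ℂ] ell2) (star shiftOp
        ((1 - (r : ℂ) • shiftOp : ell2 →L[ℂ] ell2) _)) = 0
      rw [h1, star_shiftOp_single_zero, map_zero, smul_zero]
    have h2 : (↑v⁻¹ : ell2 →L[ℂ] ell2) (lp.single 2 0 (1 : ℂ)) = 0 := by
      rw [← hu] at hker
      have := DFunLike.congr_fun u.inv_mul ((↑v⁻¹ : ell2 →L[ℂ] ell2) (lp.single 2 0 (1 : ℂ)))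
      refine this.symm.trans ?_
      change (↑u⁻¹ : ell2 →L[ℂ] ell2) ((↑u : ell2 →L[ℂ] ell2) _) = 0
      rw [hker, map_zero]
    refine single_zero_ne_zero ?_
    have := DFunLike.congr_fun v.mul_inv (lp.single 2 0 (1 : ℂ))
    refine this.symm.trans ?_
    change (↑v : ell2 →L[ℂ] ell2) ((↑v⁻¹ : ell2 →L[ℂ] ell2) _) = 0
    rw [h2, map_zero]

/-- The vectors `(εS)ⁱe₀` are orthonormal. Their sums are the approximate kernel vectors used at the
edge of the essential spectrum. -/
theorem norm_sum_smul_shiftOp_pow_sq {ε : ℂ} (hε : ‖ε‖ = 1) (N : ℕ) :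
    ‖(∑ i ∈ Finset.range N, (ε • shiftOp) ^ i : ell2 →L[ℂ] ell2)
      (lp.single 2 0 (1 : ℂ))‖ ^ 2 = N := by
  induction N with
  | zero => simp
  | succ N ih =>
    set w := (∑ i ∈ Finset.range N, (ε • shiftOp) ^ i : ell2 →L[ℂ] ell2)
      (lp.single 2 0 (1 : ℂ)) with hw
    have h1 : (∑ i ∈ Finset.range (N + 1), (ε • shiftOp) ^ i : ell2 →L[ℂ] ell2)
        (lp.single 2 0 (1 : ℂ)) = lp.single 2 0 (1 : ℂ) + ε • shiftOp w := by
      rw [geom_sum_succ, hw, add_comm]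
      rfl
    have h2 : inner ℂ (lp.single 2 0 (1 : ℂ) : ell2) (ε • shiftOp w) = 0 := by
      rw [inner_smul_right, ← ContinuousLinearMap.adjoint_inner_left,
        ← ContinuousLinearMap.star_eq_adjoint, star_shiftOp_single_zero, inner_zero_left,
        mul_zero]
    have h3 : ‖(lp.single 2 0 (1 : ℂ) : ell2)‖ = 1 := by
      rw [lp.norm_single (by norm_num), norm_one]
    have h4 := norm_add_sq_eq_norm_sq_add_norm_sq_of_inner_eq_zero _ _ h2
    rw [h1, sq, h4, h3, norm_smul, hε, norm_shiftOp_apply, one_mul, one_mul, ← sq, ih]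
    push_cast
    ring

/-- Right multiplication by `S` removes the corner term and leaves `-ε|β|(1 - εS)²`. With `w =
∑_{i<N} (εS)ⁱe₀`, the sum `(1 - εS)w` telescopes, so the image of `Sw` stays bounded while `‖Sw‖ =
√N`; no bounded inverse can exist. -/
theorem cornerJacobi_not_isUnit_of_edge {α β γ ε : ℝ} (hε : |ε| = 1) (hβ : β = ε * |β|)
    (hα : α = 2 * |β|) : ¬ IsUnit (cornerJacobi α β γ) := by
  have hε2 : (ε : ℂ) * ε = 1 := by
    rw [← Complex.ofReal_mul, ← abs_mul_abs_self, hε]; norm_num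
  have hεn : ‖(ε : ℂ)‖ = 1 := by rw [Complex.norm_real, Real.norm_eq_abs, hε]
  rintro ⟨u, hu⟩
  set V : ell2 →L[ℂ] ell2 := (ε : ℂ) • shiftOp with hV
  set b := |β| with hb
  have hVn (w : ell2) : ‖V w‖ = ‖w‖ := by
    rw [hV, smul_apply, norm_smul, hεn, one_mul, norm_shiftOp_apply]
  have hVpow (n : ℕ) (w : ell2) : ‖(V ^ n) w‖ = ‖w‖ := by
    induction n with
    | zero => simp
    | succ n ih =>
      rw [pow_succ']
      exact (hVn _).trans ih
  have hmul : cornerJacobi α β γ * shiftOp = (-(ε * b : ℂ)) • ((1 - V) * (1 - V)) := by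
    have h1 : shiftOp * star shiftOp * shiftOp = shiftOp := by
      rw [mul_assoc, star_shiftOp_mul_shiftOp, mul_one]
    have hε3 : (ε : ℂ) ^ 3 = ε := by linear_combination (ε : ℂ) * hε2
    rw [cornerJacobi, hα, hβ, hV]
    simp only [add_mul, sub_mul, mul_sub, smul_mul_assoc, mul_smul_comm, one_mul, mul_one, h1,
      star_shiftOp_mul_shiftOp]
    push_cast
    match_scalars
    · linear_combination (-2 * (b : ℂ)) * hε2
    · linear_combination (b : ℂ) * hε3
    · ring
  have hsub (w : ell2) : (1 - V) w = w - V w := rfl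
  set C := ‖(↑u⁻¹ : ell2 →L[ℂ] ell2)‖ with hC
  have hbound (N : ℕ) : (N : ℝ) ≤ (C * (b * 4)) ^ 2 := by
    set w := (∑ i ∈ Finset.range N, V ^ i : ell2 →L[ℂ] ell2) (lp.single 2 0 (1 : ℂ)) with hw
    have h1 : (1 - V) w = lp.single 2 0 (1 : ℂ) - (V ^ N) (lp.single 2 0 (1 : ℂ)) :=
      DFunLike.congr_fun (mul_neg_geom_sum V N) (lp.single 2 0 (1 : ℂ) : ell2)
    have hs : ‖(lp.single 2 0 (1 : ℂ) : ell2)‖ = 1 := by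
      rw [lp.norm_single (by norm_num), norm_one]
    have h2 : ‖(1 - V) w‖ ≤ 2 := by
      rw [h1]
      refine (norm_sub_le _ _).trans ?_
      rw [hVpow, hs]
      norm_num
    have h3 : ‖(1 - V) ((1 - V) w)‖ ≤ 4 := by
      rw [hsub]
      refine (norm_sub_le _ _).trans ?_
      rw [hVn]
      linarith
    have h4 : ‖(u : ell2 →L[ℂ] ell2) (shiftOp w)‖ ≤ b * 4 := by
      have := DFunLike.congr_fun hmul w
      rw [hu]
      change cornerJacobi α β γ (shiftOp w) = (-(ε * b : ℂ)) • (1 - V) ((1 - V) w) at this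
      rw [this, norm_smul, norm_neg, norm_mul, hεn, one_mul, Complex.norm_real, Real.norm_eq_abs,
        hb, abs_abs]
      gcongr
    have h5 : ‖w‖ ≤ C * (b * 4) := by
      have h6 : (↑u⁻¹ : ell2 →L[ℂ] ell2) ((u : ell2 →L[ℂ] ell2) (shiftOp w)) = shiftOp w :=
        DFunLike.congr_fun u.inv_mul (shiftOp w)
      have h7 := (↑u⁻¹ : ell2 →L[ℂ] ell2).le_opNorm ((u : ell2 →L[ℂ] ell2) (shiftOp w))
      rw [h6, norm_shiftOp_apply] at h7
      exact h7.trans (by gcongr)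
    rw [← norm_sum_smul_shiftOp_pow_sq hεn N]
    exact pow_le_pow_left₀ (norm_nonneg _) h5 2
  obtain ⟨N, hN⟩ := exists_nat_gt ((C * (b * 4)) ^ 2)
  exact absurd (hbound N) (not_le.mpr hN)

/-- `α` is the lower edge of the essential spectrum and the corner perturbation is weak. -/
theorem cornerJacobi_isPositive_of_le {α β γ : ℝ} (h : γ ≤ |β|) (hα : α = 2 * |β|) :
    (cornerJacobi α β γ).IsPositive ∧ ¬ IsUnit (cornerJacobi α β γ) := by
  obtain ⟨ε, hε, hβ⟩ : ∃ ε : ℝ, |ε| = 1 ∧ β = ε * |β| := by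
    rcases le_total 0 β with h0 | h0
    · exact ⟨1, by simp, by rw [abs_of_nonneg h0, one_mul]⟩
    · exact ⟨-1, by simp, by rw [abs_of_nonpos h0]; ring⟩
  refine ⟨?_, cornerJacobi_not_isUnit_of_edge hε hβ hα⟩
  have hε2 : ε ^ 2 = 1 := by rw [← sq_abs, hε, one_pow]
  have hJ := cornerJacobi_eq_mul_star (α := α) (β := β) (γ := |β|) (r := ε)
    (hβ.trans (mul_comm _ _)) (by rw [hε2, hα]; ring)
  -- At the critical corner strength `|β|` the operator factors as a square; lowering the strength
  -- to `γ` adds a nonnegative multiple of the projection onto `e₀`.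
  have hsum : cornerJacobi α β γ = cornerJacobi α β |β| +
      ((|β| - γ : ℝ) : ℂ) • (1 - shiftOp * star shiftOp) := by
    simp only [cornerJacobi]
    push_cast
    module
  rw [hsum, hJ]
  exact ((isPositive_mul_star _).smul_of_nonneg (by exact_mod_cast abs_nonneg β)).add
    (isPositive_one_sub_shiftOp_mul_star.smul_of_nonneg (by exact_mod_cast sub_nonneg.mpr h))

/-! ### The two symbols and the Wiener–Hopf factorization -/

/-- A symbol extended to complex values. -/
noncomputable def complexSymbol (f : C(Torus, ℝ)) : C(Torus, ℂ) :=
  ⟨fun x => (f x : ℂ), Complex.continuous_ofReal.comp f.continuous⟩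

theorem toeplitz_eq_contToeplitz (f : C(Torus, ℝ)) :
    toeplitz f = contToeplitz (complexSymbol f) := rfl

theorem fourier_one_add_star (x : ℝ) :
    (fourier 1 (x : Torus) : ℂ) + star (fourier 1 (x : Torus) : ℂ) = 2 * Real.cos x := by
  have h : (fourier 1 (x : Torus) : ℂ) = Complex.exp (x * Complex.I) := by
    rw [fourier_coe_apply]
    congr 1
    have : (Real.pi : ℂ) ≠ 0 := by exact_mod_cast Real.pi_ne_zero
    push_cast
    field_simp
  rw [h, RCLike.star_def, ← Complex.exp_conj, Complex.ofReal_cos, Complex.two_cos]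
  congr 2
  simp

theorem toeplitz_add_cos {a : ℝ} {f : C(Torus, ℝ)}
    (hf : ∀ x : ℝ, f (x : Torus) = a + Real.cos x) :
    toeplitz f = (a : ℂ) • 1 + ((1 / 2 : ℝ) : ℂ) • (shiftOp + star shiftOp) := by
  have h : complexSymbol f = (a : ℂ) • 1 + ((1 / 2 : ℝ) : ℂ) • (fourier 1 + star (fourier 1)) := by
    ext x
    induction x using QuotientAddGroup.induction_on with
    | H x =>
      change ((f (x : Torus) : ℝ) : ℂ) = (a : ℂ) * 1 + ((1 / 2 : ℝ) : ℂ) *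
        ((fourier 1 (x : Torus) : ℂ) + star (fourier 1 (x : Torus) : ℂ))
      rw [hf, fourier_one_add_star]
      push_cast
      ring
  rw [toeplitz_eq_contToeplitz, h, contToeplitz_add, contToeplitz_smul, contToeplitz_smul,
    contToeplitz_add, contToeplitz_one, ← star_contToeplitz, shiftOp]

theorem one_add_sq_sub_pos {θ c : ℝ} (hθ : |θ| < 1) (hc : |c| ≤ 1) :
    0 < 1 + θ ^ 2 - 2 * θ * c := by
  have h1 : θ * c ≤ |θ| := by
    calc θ * c ≤ |θ * c| := le_abs_self _
      _ = |θ| * |c| := abs_mul _ _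
      _ ≤ |θ| := mul_le_of_le_one_right (abs_nonneg _) hc
  nlinarith [sq_abs θ, sq_pos_of_pos (sub_pos.mpr hθ)]

/-- The Wiener–Hopf factorization of the Toeplitz operator of a Poisson-type kernel. -/
theorem star_mul_toeplitz_mul {θ : ℝ} (hθ : |θ| < 1) {g : C(Torus, ℝ)}
    (hg : ∀ x : ℝ, g (x : Torus) = 1 / (1 + θ ^ 2 - 2 * θ * Real.cos x)) :
    star (1 - (θ : ℂ) • shiftOp) * toeplitz g * (1 - (θ : ℂ) • shiftOp) = 1 := by
  -- This is `(1 - θe^{-ix}) g (1 - θe^{ix}) = 1`, expanded in the order in which the two operator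
  -- factors are absorbed into the symbol.
  have hsym : complexSymbol g - (θ : ℂ) • (complexSymbol g * fourier 1) -
      (θ : ℂ) • (star (fourier 1) * (complexSymbol g - (θ : ℂ) • (complexSymbol g * fourier 1)))
      = 1 := by
    ext x
    induction x using QuotientAddGroup.induction_on with
    | H x =>
      have h1 := fourier_one_add_star x
      have h2 : star (fourier 1 (x : Torus) : ℂ) * fourier 1 (x : Torus) = 1 :=
        DFunLike.congr_fun (star_fourier_mul_fourier 1) (x : Torus)
      have h3 : ((g (x : Torus) : ℝ) : ℂ) * (1 + θ ^ 2 - 2 * θ * Real.cos x) = 1 := by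
        rw [hg]
        exact_mod_cast one_div_mul_cancel
          (one_add_sq_sub_pos hθ (Real.abs_cos_le_one x)).ne'
      change ((g (x : Torus) : ℝ) : ℂ) - θ * (((g (x : Torus) : ℝ) : ℂ) * fourier 1 (x : Torus)) -
        θ * (star (fourier 1 (x : Torus) : ℂ) * (((g (x : Torus) : ℝ) : ℂ) -
          θ * (((g (x : Torus) : ℝ) : ℂ) * fourier 1 (x : Torus)))) = 1
      linear_combination h3 - (θ * ((g (x : Torus) : ℝ) : ℂ)) * h1 +
        (θ ^ 2 * ((g (x : Torus) : ℝ) : ℂ)) * h2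
  have h1 : toeplitz g * (1 - (θ : ℂ) • shiftOp) =
      contToeplitz (complexSymbol g - (θ : ℂ) • (complexSymbol g * fourier 1)) := by
    rw [mul_sub, mul_one, mul_smul_comm, toeplitz_eq_contToeplitz, contToeplitz_mul_shiftOp,
      contToeplitz_sub, contToeplitz_smul]
  rw [mul_assoc, h1, star_sub, star_one, star_smul, RCLike.star_def, Complex.conj_ofReal, sub_mul,
    one_mul, smul_mul_assoc, star_shiftOp_mul_contToeplitz, ← contToeplitz_smul,
    ← contToeplitz_sub, hsym, contToeplitz_one]

/-! ### Scalar criteria for the spectral extrema -/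

/-- The scalar conditions under which `α` is the least number making `cornerJacobi α β γ`
positive. -/
def IsCornerEdge (α β γ : ℝ) : Prop :=
  (γ ≤ |β| ∧ α = 2 * |β|) ∨ (|β| < γ ∧ α * γ = γ ^ 2 + β ^ 2)

theorem isSpectralMax_of_isCornerEdge {a b θ m : ℝ} (hθ : |θ| < 1) {F : ell2 →L[ℂ] ell2}
    {g : C(Torus, ℝ)} (hF : F = (a : ℂ) • 1 + (b : ℂ) • (shiftOp + star shiftOp))
    (hg : ∀ x : ℝ, g (x : Torus) = 1 / (1 + θ ^ 2 - 2 * θ * Real.cos x))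
    (h : IsCornerEdge (m * (1 + θ ^ 2) - a) (b + m * θ) (m * θ ^ 2)) :
    IsSpectralMax (F * toeplitz g) m := by
  have hJ := h.elim (fun h => cornerJacobi_isPositive_of_le h.1 h.2)
    (fun h => cornerJacobi_isPositive_of_lt h.1 h.2)
  refine isSpectralMax_mul_of_isPositive (isUnit_one_sub_smul_shiftOp hθ)
    (star_mul_toeplitz_mul hθ hg) ?_ hJ.1 hJ.2
  rw [hF]
  simp only [cornerJacobi, star_sub, star_smul, star_one, RCLike.star_def, Complex.conj_ofReal,
    mul_sub, sub_mul, smul_mul_assoc, mul_smul_comm, one_mul, mul_one]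
  push_cast
  module

theorem isSpectralMax_toeplitz_mul {a θ m : ℝ} (hθ : |θ| < 1) {f g : C(Torus, ℝ)}
    (hf : ∀ x : ℝ, f (x : Torus) = a + Real.cos x)
    (hg : ∀ x : ℝ, g (x : Torus) = 1 / (1 + θ ^ 2 - 2 * θ * Real.cos x))
    (h : IsCornerEdge (m * (1 + θ ^ 2) - a) (1 / 2 + m * θ) (m * θ ^ 2)) :
    IsSpectralMax (toeplitz f * toeplitz g) m :=
  isSpectralMax_of_isCornerEdge hθ (toeplitz_add_cos hf) hg h

/-- The hypothesis is the criterion for the maximum at `(-a, -θ, -m)`, so the lemmas about the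
maximum serve for the minimum too. -/
theorem isSpectralMin_toeplitz_mul {a θ m : ℝ} (hθ : |θ| < 1) {f g : C(Torus, ℝ)}
    (hf : ∀ x : ℝ, f (x : Torus) = a + Real.cos x)
    (hg : ∀ x : ℝ, g (x : Torus) = 1 / (1 + θ ^ 2 - 2 * θ * Real.cos x))
    (h : IsCornerEdge (-m * (1 + (-θ) ^ 2) - -a) (1 / 2 + -m * -θ) (-m * (-θ) ^ 2)) :
    IsSpectralMin (toeplitz f * toeplitz g) m := by
  refine IsSpectralMax.neg ?_
  rw [← neg_mul]
  refine isSpectralMax_of_isCornerEdge (a := -a) (b := -(1 / 2)) hθ ?_ hg ?_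
  · rw [toeplitz_add_cos hf]
    push_cast
    module
  -- Passing to `-T(f)` with `g` fixed only flips the sign of `β`, and the criterion sees `β`
  -- through `|β|` and `β²` alone.
  · have hβ : -(1 / 2) + -m * θ = -(1 / 2 + -m * -θ) := by ring
    rw [IsCornerEdge, hβ, abs_neg, neg_sq (1 / 2 + -m * -θ)]
    rwa [IsCornerEdge, neg_sq θ] at h

/-! ### Locating the edge: scalar inequalities -/

/-- The function `m/g - f` equals `α - 2β cos x`, whose minimum `α - 2|β|` is 0 when `m = sup(fg)`.
The endpoint attaining the maximum determines the sign of `β`. -/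
theorem sup_edge_identity {a θ : ℝ} (hθ : |θ| < 1) {m : ℝ}
    (hm : m = max ((a - 1) / (1 + θ) ^ 2) ((a + 1) / (1 - θ) ^ 2)) :
    m * (1 + θ ^ 2) - a = 2 * |1 / 2 + m * θ| := by
  obtain ⟨h1, h2⟩ := abs_lt.mp hθ
  have hp : 0 < (1 + θ) ^ 2 := by have : 0 < 1 + θ := by linarith
                                  positivity
  have hq : 0 < (1 - θ) ^ 2 := by have : 0 < 1 - θ := by linarith
                                  positivity
  have hm1 : a - 1 ≤ m * (1 + θ) ^ 2 := (div_le_iff₀ hp).mp (hm ▸ le_max_left _ _)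
  have hm2 : a + 1 ≤ m * (1 - θ) ^ 2 := (div_le_iff₀ hq).mp (hm ▸ le_max_right _ _)
  rcases max_choice ((a - 1) / (1 + θ) ^ 2) ((a + 1) / (1 - θ) ^ 2) with h | h <;>
    rw [h] at hm
  · rw [eq_div_iff hp.ne'] at hm
    rw [abs_of_nonpos (by nlinarith)]
    nlinarith
  · rw [eq_div_iff hq.ne'] at hm
    rw [abs_of_nonneg (by nlinarith)]
    nlinarith

theorem isCornerEdge_sup_of_nonneg {a θ m : ℝ} (hθ : |θ| < 1) (h0 : 0 ≤ θ)
    (hm : m = max ((a - 1) / (1 + θ) ^ 2) ((a + 1) / (1 - θ) ^ 2)) :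
    IsCornerEdge (m * (1 + θ ^ 2) - a) (1 / 2 + m * θ) (m * θ ^ 2) := by
  refine Or.inl ⟨?_, sup_edge_identity hθ hm⟩
  have h1 := (abs_lt.mp hθ).2
  rcases le_total 0 m with h | h
  · refine le_trans ?_ (le_abs_self _)
    nlinarith [mul_nonneg (mul_nonneg h h0) (sub_nonneg.mpr h1.le)]
  · exact (mul_nonpos_of_nonpos_of_nonneg h (sq_nonneg θ)).trans (abs_nonneg _)

/-- Clearing denominators turns membership into bounds on `1 + aθ`, the quantity in the eigenvalue
formula. -/
theorem mem_Ioo_iff_of_neg {a θ : ℝ} (h0 : θ < 0) :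
    a ∈ Set.Ioo (-(1 + θ) / (2 * θ)) (-(1 - θ) / (2 * θ)) ↔
      1 + θ < 2 * (1 + a * θ) ∧ 2 * (1 + a * θ) < 1 - θ := by
  have h : 2 * θ < 0 := by linarith
  rw [Set.mem_Ioo, div_lt_iff_of_neg h, lt_div_iff_of_neg h]
  constructor <;> rintro ⟨h1, h2⟩ <;> constructor <;> linarith

theorem isCornerEdge_sup_of_notMem {a θ m : ℝ} (hθ : |θ| < 1) (h0 : θ < 0)
    (ha : a ∉ Set.Ioo (-(1 + θ) / (2 * θ)) (-(1 - θ) / (2 * θ)))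
    (hm : m = max ((a - 1) / (1 + θ) ^ 2) ((a + 1) / (1 - θ) ^ 2)) :
    IsCornerEdge (m * (1 + θ ^ 2) - a) (1 / 2 + m * θ) (m * θ ^ 2) := by
  refine Or.inl ⟨?_, sup_edge_identity hθ hm⟩
  rw [mem_Ioo_iff_of_neg h0, not_and_or, not_lt, not_lt] at ha
  have h1 := (abs_lt.mp hθ).1
  have hpos : 0 < 1 + θ := by linarith
  have hpos' : 0 < 1 - θ := by linarith
  rcases ha with ha | ha
  -- Here `-β ≥ γ`, which amounts to `mθ(1 + θ) ≤ -1/2`; the value of `fg` at `π` gives the needed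
  -- lower bound on `m`.
  · have hm1 : a - 1 ≤ m * (1 + θ) ^ 2 :=
      (div_le_iff₀ (by positivity)).mp (hm ▸ le_max_left _ _)
    refine le_trans ?_ (neg_le_abs _)
    have h2 := mul_le_mul_of_nonpos_right hm1 h0.le
    have h3 : (1 + θ) * (m * θ * (1 + θ)) ≤ (1 + θ) * (-(1 / 2)) := by nlinarith
    have h4 := le_of_mul_le_mul_left h3 hpos
    nlinarith
  · refine le_trans ?_ (le_abs_self _)
    -- This bound is exactly `γ ≤ β`, that is `-mθ(1 - θ) ≤ 1/2`.
    have hmle : m ≤ 1 / (2 * -θ * (1 - θ)) := by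
      have hd : 0 < 2 * -θ * (1 - θ) := by nlinarith
      rw [hm]
      refine max_le ?_ ?_
      · rw [div_le_div_iff₀ (by positivity) hd]
        nlinarith [mul_le_mul_of_nonneg_right ha hpos'.le, sq_nonneg θ]
      · rw [div_le_div_iff₀ (by positivity) hd]
        nlinarith [mul_le_mul_of_nonneg_right ha hpos'.le, sq_nonneg θ]
    rw [le_div_iff₀ (by nlinarith)] at hmle
    nlinarith

theorem isCornerEdge_of_mem {a θ : ℝ} (hθ : |θ| < 1) (h0 : θ < 0)
    (ha : a ∈ Set.Ioo (-(1 + θ) / (2 * θ)) (-(1 - θ) / (2 * θ))) {m : ℝ}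
    (hm : m = 1 / (-4 * θ * (1 + a * θ))) :
    IsCornerEdge (m * (1 + θ ^ 2) - a) (1 / 2 + m * θ) (m * θ ^ 2) ∧
      max ((a - 1) / (1 + θ) ^ 2) ((a + 1) / (1 - θ) ^ 2) < m := by
  rw [mem_Ioo_iff_of_neg h0] at ha
  obtain ⟨ha1, ha2⟩ := ha
  have h1 := (abs_lt.mp hθ).1
  have hpos : 0 < 1 + θ := by linarith
  have hpos' : 0 < 1 - θ := by linarith
  have hs : 0 < 1 + a * θ := by linarith
  have hd : 0 < -4 * θ * (1 + a * θ) := mul_pos (by linarith) hs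
  have hmpos : 0 < m := hm ▸ one_div_pos.mpr hd
  have hmd : m * (-4 * θ * (1 + a * θ)) = 1 := by rw [hm, one_div_mul_cancel hd.ne']
  refine ⟨Or.inr ⟨?_, ?_⟩, ?_⟩
  · have hpm : 0 < m * -θ := mul_pos hmpos (by linarith)
    rw [abs_lt]
    constructor <;> nlinarith
  -- In `αγ = γ² + β²` the terms quadratic in `m` cancel, leaving `-4mθ(1 + aθ) = 1`.
  · linear_combination (1 / 4) * hmd
  · rw [hm, max_lt_iff, div_lt_div_iff₀ (by positivity) hd, div_lt_div_iff₀ (by positivity) hd]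
    -- With `s = 1 + aθ`, the two gaps after cross-multiplication are the squares `(2s - (1 + θ))²`
    -- and `(2s - (1 - θ))²`, nonzero inside the open interval.
    constructor
    · nlinarith [sq_pos_of_pos (sub_pos.mpr ha1)]
    · nlinarith [sq_pos_of_pos (sub_pos.mpr ha2)]

/-! ### Norms of the symbols and extrema of their product -/

theorem norm_add_cos {a : ℝ} {f : C(Torus, ℝ)}
    (hf : ∀ x : ℝ, f (x : Torus) = a + Real.cos x) : ‖f‖ = |a| + 1 := by
  refine le_antisymm ((ContinuousMap.norm_le _ (by positivity)).mpr fun x => ?_) ?_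
  · induction x using QuotientAddGroup.induction_on with
    | H x =>
      change ‖f (x : Torus)‖ ≤ _
      rw [hf, Real.norm_eq_abs]
      exact (abs_add_le _ _).trans (by gcongr; exact Real.abs_cos_le_one x)
  · have h1 := f.norm_coe_le_norm ((0 : ℝ) : Torus)
    have h2 := f.norm_coe_le_norm ((Real.pi : ℝ) : Torus)
    rw [hf, Real.cos_zero, Real.norm_eq_abs] at h1
    rw [hf, Real.cos_pi, Real.norm_eq_abs] at h2
    rcases abs_cases a with h | h
    · linarith [le_abs_self (a + 1)]
    · linarith [neg_le_abs (a + -1)]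

theorem norm_one_div_poisson {θ : ℝ} (hθ : |θ| < 1) {g : C(Torus, ℝ)}
    (hg : ∀ x : ℝ, g (x : Torus) = 1 / (1 + θ ^ 2 - 2 * θ * Real.cos x)) :
    ‖g‖ = 1 / (1 - |θ|) ^ 2 := by
  have hpos : 0 < (1 - |θ|) ^ 2 := by have := sub_pos.mpr hθ
                                      positivity
  refine le_antisymm ((ContinuousMap.norm_le _ (by positivity)).mpr fun x => ?_) ?_
  · induction x using QuotientAddGroup.induction_on with
    | H x =>
      change ‖g (x : Torus)‖ ≤ _
      rw [hg, Real.norm_eq_abs, abs_of_pos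
        (one_div_pos.mpr (one_add_sq_sub_pos hθ (Real.abs_cos_le_one x)))]
      refine one_div_le_one_div_of_le hpos ?_
      have h1 : θ * Real.cos x ≤ |θ| := by
        calc θ * Real.cos x ≤ |θ * Real.cos x| := le_abs_self _
          _ = |θ| * |Real.cos x| := abs_mul _ _
          _ ≤ |θ| := mul_le_of_le_one_right (abs_nonneg _) (Real.abs_cos_le_one x)
      nlinarith [sq_abs θ]
  · obtain ⟨x, hx⟩ : ∃ x : ℝ, θ * Real.cos x = |θ| := by
      rcases abs_cases θ with h | h
      · exact ⟨0, by rw [Real.cos_zero]; linarith⟩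
      · exact ⟨Real.pi, by rw [Real.cos_pi]; linarith⟩
    refine le_trans (le_of_eq ?_) ((le_abs_self _).trans (g.norm_coe_le_norm (x : Torus)))
    rw [hg, mul_assoc, hx, ← sq_abs θ]
    congr 1
    ring

theorem mul_apply_cos_zero {a θ : ℝ} {f g : C(Torus, ℝ)}
    (hf : ∀ x : ℝ, f (x : Torus) = a + Real.cos x)
    (hg : ∀ x : ℝ, g (x : Torus) = 1 / (1 + θ ^ 2 - 2 * θ * Real.cos x)) :
    f ((0 : ℝ) : Torus) * g ((0 : ℝ) : Torus) = (a + 1) / (1 - θ) ^ 2 := by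
  rw [hf, hg, Real.cos_zero, mul_one_div]
  congr 1
  ring

theorem mul_apply_cos_pi {a θ : ℝ} {f g : C(Torus, ℝ)}
    (hf : ∀ x : ℝ, f (x : Torus) = a + Real.cos x)
    (hg : ∀ x : ℝ, g (x : Torus) = 1 / (1 + θ ^ 2 - 2 * θ * Real.cos x)) :
    f ((Real.pi : ℝ) : Torus) * g ((Real.pi : ℝ) : Torus) = (a - 1) / (1 + θ) ^ 2 := by
  rw [hf, hg, Real.cos_pi, mul_one_div]
  congr 1
  ring

/-- Once the positive denominator is cleared, the inequality is affine in `cos x`, so the cases `cos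
x = ±1` suffice. -/
theorem add_cos_mul_le {a θ : ℝ} (hθ : |θ| < 1) (x : ℝ) :
    (a + Real.cos x) * (1 / (1 + θ ^ 2 - 2 * θ * Real.cos x)) ≤
      max ((a - 1) / (1 + θ) ^ 2) ((a + 1) / (1 - θ) ^ 2) := by
  obtain ⟨h1, h2⟩ := abs_lt.mp hθ
  have hp : 0 < 1 + θ := by linarith
  have hq : 0 < 1 - θ := by linarith
  set m := max ((a - 1) / (1 + θ) ^ 2) ((a + 1) / (1 - θ) ^ 2) with hm
  have hm1 : a - 1 ≤ m * (1 + θ) ^ 2 := (div_le_iff₀ (by positivity)).mp (hm ▸ le_max_left _ _)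
  have hm2 : a + 1 ≤ m * (1 - θ) ^ 2 := (div_le_iff₀ (by positivity)).mp (hm ▸ le_max_right _ _)
  rw [mul_one_div, div_le_iff₀ (one_add_sq_sub_pos hθ (Real.abs_cos_le_one x))]
  nlinarith [mul_le_mul_of_nonneg_right hm1 (sub_nonneg.mpr (Real.cos_le_one x)),
    mul_le_mul_of_nonneg_right hm2 (neg_le_iff_add_nonneg.mp (Real.neg_one_le_cos x))]

theorem max_neg_symm (a θ : ℝ) :
    max ((-a - 1) / (1 + -θ) ^ 2) ((-a + 1) / (1 - -θ) ^ 2) =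
      -min ((a - 1) / (1 + θ) ^ 2) ((a + 1) / (1 - θ) ^ 2) := by
  rw [← max_neg_neg, max_comm, ← neg_div, ← neg_div]
  congr 2 <;> ring

theorem le_add_cos_mul {a θ : ℝ} (hθ : |θ| < 1) (x : ℝ) :
    min ((a - 1) / (1 + θ) ^ 2) ((a + 1) / (1 - θ) ^ 2) ≤
      (a + Real.cos x) * (1 / (1 + θ ^ 2 - 2 * θ * Real.cos x)) := by
  -- Translation by `π` changes `(a, θ)` to `(-a, -θ)` and the sign of the product, turning the
  -- upper bound into the lower one.
  have h := add_cos_mul_le (a := -a) (θ := -θ) (by rwa [abs_neg]) (x + Real.pi)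
  rw [max_neg_symm, Real.cos_add_pi] at h
  have h2 : 1 + (-θ) ^ 2 - 2 * -θ * -Real.cos x = 1 + θ ^ 2 - 2 * θ * Real.cos x := by ring
  rw [h2] at h
  linarith

theorem iSup_mul_eq {a θ : ℝ} (hθ : |θ| < 1) {f g : C(Torus, ℝ)}
    (hf : ∀ x : ℝ, f (x : Torus) = a + Real.cos x)
    (hg : ∀ x : ℝ, g (x : Torus) = 1 / (1 + θ ^ 2 - 2 * θ * Real.cos x)) :
    (⨆ x : Torus, f x * g x) = max ((a - 1) / (1 + θ) ^ 2) ((a + 1) / (1 - θ) ^ 2) := by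
  have h : ∀ x : Torus, f x * g x ≤ max ((a - 1) / (1 + θ) ^ 2) ((a + 1) / (1 - θ) ^ 2) := by
    intro x
    induction x using QuotientAddGroup.induction_on with
    | H x =>
      rw [hf, hg]
      exact add_cos_mul_le hθ x
  have hb : BddAbove (Set.range fun x : Torus => f x * g x) := ⟨_, Set.forall_mem_range.mpr h⟩
  refine le_antisymm (ciSup_le h) (max_le ?_ ?_)
  · exact (mul_apply_cos_pi hf hg).symm.le.trans (le_ciSup hb _)
  · exact (mul_apply_cos_zero hf hg).symm.le.trans (le_ciSup hb _)

theorem iInf_mul_eq {a θ : ℝ} (hθ : |θ| < 1) {f g : C(Torus, ℝ)}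
    (hf : ∀ x : ℝ, f (x : Torus) = a + Real.cos x)
    (hg : ∀ x : ℝ, g (x : Torus) = 1 / (1 + θ ^ 2 - 2 * θ * Real.cos x)) :
    (⨅ x : Torus, f x * g x) = min ((a - 1) / (1 + θ) ^ 2) ((a + 1) / (1 - θ) ^ 2) := by
  have h : ∀ x : Torus, min ((a - 1) / (1 + θ) ^ 2) ((a + 1) / (1 - θ) ^ 2) ≤ f x * g x := by
    intro x
    induction x using QuotientAddGroup.induction_on with
    | H x =>
      rw [hf, hg]
      exact le_add_cos_mul hθ x
  have hb : BddBelow (Set.range fun x : Torus => f x * g x) := ⟨_, Set.forall_mem_range.mpr h⟩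
  refine le_antisymm (le_min ?_ ?_) (le_ciInf h)
  · exact (ciInf_le hb _).trans (mul_apply_cos_pi hf hg).le
  · exact (ciInf_le hb _).trans (mul_apply_cos_zero hf hg).le

/-! ### Reflection symmetry and the main theorem -/

theorem neg_mem_Ioo_iff {a θ : ℝ} :
    -a ∈ Set.Ioo (-(1 + -θ) / (2 * -θ)) (-(1 - -θ) / (2 * -θ)) ↔
      a ∈ Set.Ioo (-(1 + θ) / (2 * θ)) (-(1 - θ) / (2 * θ)) := by
  have h1 : -(1 + -θ) / (2 * -θ) = -(-(1 - θ) / (2 * θ)) := by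
    rw [mul_neg, div_neg, ← sub_eq_add_neg]
  have h2 : -(1 - -θ) / (2 * -θ) = -(-(1 + θ) / (2 * θ)) := by
    rw [mul_neg, div_neg, sub_neg_eq_add]
  rw [h1, h2, Set.mem_Ioo, Set.mem_Ioo, neg_lt_neg_iff, neg_lt_neg_iff, and_comm]

/-- Spectral extrema of `T(f)T(g)` for `f(x) = a + cos x` and
`g(x) = 1 / (1 + θ² - 2θ cos x)`. -/
theorem mainTheorem4 (a θ : ℝ) (hθ : |θ| < 1) (f g : C(Torus, ℝ))
    (hf : ∀ x : ℝ, f (x : Torus) = a + Real.cos x)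
    (hg : ∀ x : ℝ, g (x : Torus) = 1 / (1 + θ ^ 2 - 2 * θ * Real.cos x)) :
    -- sup norms of the symbols, and the extrema of `fg`
    ‖f‖ = |a| + 1 ∧ ‖g‖ = 1 / (1 - |θ|) ^ 2 ∧
    (⨅ x : Torus, f x * g x) = min ((a - 1) / (1 + θ) ^ 2) ((a + 1) / (1 - θ) ^ 2) ∧
    (⨆ x : Torus, f x * g x) = max ((a - 1) / (1 + θ) ^ 2) ((a + 1) / (1 - θ) ^ 2) ∧
    -- the case `θ = 0`
    (θ = 0 → g = 1 ∧ toeplitz f * toeplitz g = toeplitz f ∧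
      IsSpectralMax (toeplitz f * toeplitz g) (a + 1) ∧
      IsSpectralMin (toeplitz f * toeplitz g) (a - 1)) ∧
    -- the case `θ > 0`
    (0 < θ →
      IsSpectralMax (toeplitz f * toeplitz g) (⨆ x : Torus, f x * g x) ∧
      (a ∈ Set.Ioo (-(1 + θ) / (2 * θ)) (-(1 - θ) / (2 * θ)) →
        IsSpectralMin (toeplitz f * toeplitz g) (1 / (-4 * θ * (1 + a * θ))) ∧
        1 / (-4 * θ * (1 + a * θ)) < ⨅ x : Torus, f x * g x) ∧
      (a ∉ Set.Ioo (-(1 + θ) / (2 * θ)) (-(1 - θ) / (2 * θ)) →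
        IsSpectralMin (toeplitz f * toeplitz g) (⨅ x : Torus, f x * g x))) ∧
    -- the case `θ < 0`
    (θ < 0 →
      IsSpectralMin (toeplitz f * toeplitz g) (⨅ x : Torus, f x * g x) ∧
      (a ∈ Set.Ioo (-(1 + θ) / (2 * θ)) (-(1 - θ) / (2 * θ)) →
        IsSpectralMax (toeplitz f * toeplitz g) (1 / (-4 * θ * (1 + a * θ))) ∧
        (⨆ x : Torus, f x * g x) < 1 / (-4 * θ * (1 + a * θ))) ∧
      (a ∉ Set.Ioo (-(1 + θ) / (2 * θ)) (-(1 - θ) / (2 * θ)) →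
        IsSpectralMax (toeplitz f * toeplitz g) (⨆ x : Torus, f x * g x))) := by
  have hinf := iInf_mul_eq hθ hf hg
  have hsup := iSup_mul_eq hθ hf hg
  have hθ' : |(-θ)| < 1 := by rwa [abs_neg]
  have hneg : -(⨅ x : Torus, f x * g x) =
      max ((-a - 1) / (1 + -θ) ^ 2) ((-a + 1) / (1 - -θ) ^ 2) := by
    rw [hinf, max_neg_symm]
  refine ⟨norm_add_cos hf, norm_one_div_poisson hθ hg, hinf, hsup, fun h0 => ?_, fun h0 => ?_,
    fun h0 => ?_⟩
  · have hmax := isSpectralMax_toeplitz_mul hθ hf hg (isCornerEdge_sup_of_nonneg hθ h0.ge hsup)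
    have hmin := isSpectralMin_toeplitz_mul hθ hf hg
      (isCornerEdge_sup_of_nonneg hθ' (by rw [h0, neg_zero]) hneg)
    have hg1 : g = 1 := by
      ext x
      induction x using QuotientAddGroup.induction_on with
      | H x =>
        change g (x : Torus) = 1
        rw [hg, h0]
        norm_num
    have hT : toeplitz g = 1 := by
      have : complexSymbol g = 1 := by
        ext x
        simp [complexSymbol, hg1]
      rw [toeplitz_eq_contToeplitz, this, contToeplitz_one]
    refine ⟨hg1, by rw [hT, mul_one], ?_, ?_⟩
    · convert hmax
      rw [hsup, h0, max_eq_right] <;> norm_num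
      linarith
    · convert hmin
      rw [hinf, h0, min_eq_left] <;> norm_num
      linarith
  · refine ⟨isSpectralMax_toeplitz_mul hθ hf hg (isCornerEdge_sup_of_nonneg hθ h0.le hsup),
      fun ha => ?_, fun ha => ?_⟩
    -- The eigenvalue formula is odd under `(a, θ) ↦ (-a, -θ)`, so the case of negative parameter
    -- applies to `-θ`.
    · have hm : -(1 / (-4 * θ * (1 + a * θ))) = 1 / (-4 * -θ * (1 + -a * -θ)) := by
        rw [neg_mul_neg a θ, mul_neg, neg_mul _ (1 + a * θ), div_neg]
      obtain ⟨h1, h2⟩ := isCornerEdge_of_mem hθ' (neg_lt_zero.mpr h0) (neg_mem_Ioo_iff.mpr ha) hm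
      rw [← hneg, neg_lt_neg_iff] at h2
      exact ⟨isSpectralMin_toeplitz_mul hθ hf hg h1, h2⟩
    · exact isSpectralMin_toeplitz_mul hθ hf hg (isCornerEdge_sup_of_notMem hθ'
        (neg_lt_zero.mpr h0) (fun h => ha (neg_mem_Ioo_iff.mp h)) hneg)
  · refine ⟨isSpectralMin_toeplitz_mul hθ hf hg
      (isCornerEdge_sup_of_nonneg hθ' (neg_nonneg.mpr h0.le) hneg), fun ha => ?_, fun ha => ?_⟩
    · obtain ⟨h1, h2⟩ := isCornerEdge_of_mem hθ h0 ha rfl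
      exact ⟨isSpectralMax_toeplitz_mul hθ hf hg h1, hsup ▸ h2⟩
    · exact isSpectralMax_toeplitz_mul hθ hf hg (isCornerEdge_sup_of_notMem hθ h0 ha hsup)
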